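/- Let $\mathcal H$ be a finite-dimensional complex Hilbert space, let $\hbar>0$, let $H=H^\dagger$ and $L_1,\dots,L_p$ be linear operators on $\mathcal H$, and consider the Lindblad generator $$\mathcal L[\rho]=-\frac{i}{\hbar}[H,\rho]+\sum_{k=1}^p\Big(L_k\rho L_k^\dagger-\tfrac12\{L_k^\dagger L_k,\rho\}\Big)$$ with semigroup $\mathcal T_t=e^{t\mathcal L}$, $t\ge 0$. Let $\mathcal H=\mathcal H_S\oplus\mathcal H_R$ be an orthogonal decomposition. Write operators as block matrices $X=\begin{bmatrix}X_S&X_P\\X_Q&X_R\end{bmatrix}$ in orthonormal bases of $\mathcal H_S$ and $\mathcal H_R$. Let $\mathfrak D(\mathcal H)$ be the set of density operators (positive semidefinite, trace one), and let $\mathfrak I_S(\mathcal H)$ be the set of density operators $\rho$ with $\rho_P=0$, $\rho_Q=0$, $\rho_R=0$. The subspace $\mathcal H_S$ is called invariant if $\mathcal T_t(\mathfrak I_S(\mathcal H))\subseteq\mathfrak I_S(\mathcal H)$ for all $t\ge0$. It is called globally asymptotically stable (GAS) if it is invariant and, for every $\rho\in\mathfrak D(\mathcal H)$, $$\lim_{t\to\infty}\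 \inf_{\tau\in\mathfrak I_S(\mathcal H)}\|\mathcal T_t(\rho)-\tau\|=0,$$ where $\inf\emptyset=+\infty$. Define $$\hat{\mathcal L}_R=-\frac{i}{\hbar}\big(\mathbf 1_R\otimes H_R-H_R^T\otimes\mathbf 1_R\big)+\sum_k L_{R,k}^*\otimes L_{R,k}-\frac12\sum_k\mathbf 1_R\otimes\big(L_{P,k}^\dagger L_{P,k}+L_{R,k}^\dagger L_{R,k}\big)-\frac12\sum_k\big(L_{P,k}^TL_{P,k}^*+L_{R,k}^TL_{R,k}^*\big)\otimes\mathbf 1_R,$$ where $\otimes$ is the Kronecker product, $^*$ is entrywise complex conjugation, and $H_R,L_{R,k},L_{P,k}$ are the corresponding blocks of $H$ and $L_k$. **Theorem (Subspace Attractivity).** Assume that $\mathcal H_S$ is invariant. Then $\mathcal H_S$ is GAS if and only if $\hat{\mathcal L}_R$ does not have a zero eigenvalue. Moreover, the $R$-block of the state evolves autonomously under $\hat{\mathcal L}_R$: for every $\rho\in\mathfrak D(\mathcal H)$ and $t\ge 0$, $$\frac{d}{dt}\,\mathrm{vec}\big((\mathcal T_t\rho)_R\big)=\hat{\mathcal L}_R\,\mathrm{vec}\big((\mathcal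 T_t\rho)_R\big),$$ where $\mathrm{vec}$ stacks the columns of a matrix. -/

import Mathlib

open scoped Kronecker

noncomputable section

namespace QDS

variable {V : Type*} [NormedAddCommGroup V] [InnerProductSpace ℂ V] [CompleteSpace V]
  [FiniteDimensional ℂ V]

/-- The density operators (states): positive semidefinite operators of trace one. -/
def densityOperators (V : Type*) [NormedAddCommGroup V] [InnerProductSpace ℂ V] :
    Set (V →L[ℂ] V) :=
  {ρ | ρ.IsPositive ∧ LinearMap.trace ℂ V (ρ : V →ₗ[ℂ] V) = 1}

/-- The Lindblad generator
`ρ ↦ -(i/ħ) [H, ρ] + ∑ₖ (Lₖ ρ Lₖ† - ½ {Lₖ† Lₖ, ρ})`, as a linear map on operators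
(products are compositions of operators). -/
def lindbladLinear (hbar : ℝ) (H : V →L[ℂ] V) {p : ℕ} (L : Fin p → V →L[ℂ] V) :
    (V →L[ℂ] V) →ₗ[ℂ] (V →L[ℂ] V) where
  toFun ρ := -(Complex.I / (hbar : ℂ)) • (H * ρ - ρ * H) +
    ∑ k, (L k * ρ * (L k).adjoint -
      (1 / 2 : ℂ) • ((L k).adjoint * L k * ρ + ρ * ((L k).adjoint * L k)))
  map_add' ρ σ := by
    simp only [mul_add, add_mul, smul_sub, smul_add, Finset.sum_add_distrib,
      Finset.sum_sub_distrib]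
    abel
  map_smul' c ρ := by
    simp only [mul_smul_comm, smul_mul_assoc, RingHom.id_apply, smul_add, smul_sub,
      Finset.smul_sum, smul_comm c]

/-- The Lindblad generator as a bounded operator on the finite-dimensional space of operators. -/
def lindblad (hbar : ℝ) (H : V →L[ℂ] V) {p : ℕ} (L : Fin p → V →L[ℂ] V) :
    (V →L[ℂ] V) →L[ℂ] (V →L[ℂ] V) :=
  LinearMap.toContinuousLinearMap (lindbladLinear hbar H L)

/-- The semigroup `T_t = exp (t 𝓛)` generated by `𝓛`: `t ↦ T_t ρ` is the solution of
`dρ/dt = 𝓛 ρ` that starts at `ρ`. -/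
def evolution {E : Type*} [NormedAddCommGroup E] [NormedSpace ℂ E] (G : E →L[ℂ] E) (t : ℝ) :
    E →L[ℂ] E :=
  NormedSpace.exp (t • G)

/-- The states supported on the subspace `S`: the states of block form `[ρ_S, 0; 0, 0]` with
respect to `S ⊕ Sᗮ`, i.e. `ρ = Π_S ρ Π_S` with `Π_S` the orthogonal projection onto `S`. -/
def statesOn (S : Submodule ℂ V) : Set (V →L[ℂ] V) :=
  {ρ | ρ ∈ densityOperators V ∧ S.starProjection * ρ * S.starProjection = ρ}

/-- Trajectories that start in `W` stay in `W` at all positive times. -/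
def IsInvariantSet (G : (V →L[ℂ] V) →L[ℂ] (V →L[ℂ] V)) (W : Set (V →L[ℂ] V)) : Prop :=
  ∀ ρ ∈ W, ∀ t : ℝ, 0 ≤ t → evolution G t ρ ∈ W

/-- The subspace `S` is invariant: the set of states supported on `S` is invariant. -/
def IsInvariantSubspace (G : (V →L[ℂ] V) →L[ℂ] (V →L[ℂ] V)) (S : Submodule ℂ V) : Prop :=
  IsInvariantSet G (statesOn S)

/-- The subspace `S` is attractive: the distance `inf_τ ‖T_t ρ - τ‖` from `T_t ρ` to the set of
states `τ` supported on `S` tends to zero for every initial state `ρ`. The distance is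
extended-valued, with the convention `inf ∅ = ∞` (relevant for `S = 0` only). -/
def IsAttractiveSubspace (G : (V →L[ℂ] V) →L[ℂ] (V →L[ℂ] V)) (S : Submodule ℂ V) : Prop :=
  ∀ ρ ∈ densityOperators V,
    Filter.Tendsto (fun t : ℝ => Metric.infEDist (evolution G t ρ) (statesOn S))
      Filter.atTop (nhds 0)

/-- Globally asymptotically stable: invariant and attractive. -/
def IsGAS (G : (V →L[ℂ] V) →L[ℂ] (V →L[ℂ] V)) (S : Submodule ℂ V) : Prop :=
  IsInvariantSubspace G S ∧ IsAttractiveSubspace G S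

/-- The block `X_P` (from `Sᗮ` to `S`) of the matrix of `X` in orthonormal bases of `S`, `Sᗮ`. -/
def blockP {S : Submodule ℂ V} {m r : ℕ} (bS : OrthonormalBasis (Fin m) ℂ S)
    (bR : OrthonormalBasis (Fin r) ℂ Sᗮ) (X : V →L[ℂ] V) : Matrix (Fin m) (Fin r) ℂ :=
  Matrix.of fun i j => inner ℂ (bS i : V) (X (bR j : V))

/-- The block `X_R` (from `Sᗮ` to `Sᗮ`) of the matrix of `X` in an orthonormal basis of `Sᗮ`. -/
def blockR {S : Submodule ℂ V} {r : ℕ}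
    (bR : OrthonormalBasis (Fin r) ℂ Sᗮ) (X : V →L[ℂ] V) : Matrix (Fin r) (Fin r) ℂ :=
  Matrix.of fun i j => inner ℂ (bR i : V) (X (bR j : V))

/-- The vectorized reduced generator, built from the matrix blocks `H_R`, `L_{R,k}`, `L_{P,k}`.
Here `M.map star` is the entrywise complex conjugate `M^*`, and `Mᴴ` is `M^†`. -/
def reducedGenerator (hbar : ℝ) {m r p : ℕ} (HR : Matrix (Fin r) (Fin r) ℂ)
    (LR : Fin p → Matrix (Fin r) (Fin r) ℂ) (LP : Fin p → Matrix (Fin m) (Fin r) ℂ) :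
    Matrix (Fin r × Fin r) (Fin r × Fin r) ℂ :=
  -(Complex.I / (hbar : ℂ)) •
      ((1 : Matrix (Fin r) (Fin r) ℂ) ⊗ₖ HR - HR.transpose ⊗ₖ (1 : Matrix (Fin r) (Fin r) ℂ))
    + ∑ k, (LR k).map star ⊗ₖ LR k
    - (1 / 2 : ℂ) • (∑ k, (1 : Matrix (Fin r) (Fin r) ℂ) ⊗ₖ
        ((LP k).conjTranspose * LP k + (LR k).conjTranspose * LR k))
    - (1 / 2 : ℂ) • (∑ k, ((LP k).transpose * (LP k).map star
        + (LR k).transpose * (LR k).map star) ⊗ₖ (1 : Matrix (Fin r) (Fin r) ℂ))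

end QDS

end

/-! Differentiating a trajectory of states on `S` at time zero shows that invariance forces every `L
k` and the drift `-(i/ħ) H - ½ ∑ Lₖ† Lₖ` to map `S` into itself. The `R`-block of the generator then
involves only the `R`-block of its argument, which gives the autonomous equation
(`vec_blockR_lindblad`).

If the reduced generator `A` is singular, a left null vector `w` yields a conserved functional `w ⬝ᵥ
vec ρ_R` that vanishes on states supported on `S`. Attractivity makes it vanish on all states, and
polarization gives `w = 0`.

If `A` is invertible, `tr ρ_R` along a trajectory is the derivative of the bounded function `(vec 1
ᵥ* A⁻¹) ⬝ᵥ vec ρ_R`. It is also nonnegative and nonincreasing, hence tends to zero. States with `tr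
ρ_R = 0` are supported on `S`, so compactness of the state space turns this into convergence of the
distance. No spectral analysis of `A` beyond invertibility is needed.

Both monotonicity and compactness rely on the semigroup preserving states; positivity comes from a
product formula with positive Euler steps. -/

noncomputable section

open Filter Topology Matrix

namespace QDS

/-! ### Chernoff product formula -/

section Chernoff

set_option linter.unusedSectionVars false

variable {A : Type*} [NormedRing A] [NormOneClass A]

theorem norm_pow_sub_pow_le_of_norm_le {a b : A} {K : ℝ} (hK : 1 ≤ K) (ha : ‖a‖ ≤ K)
    (hb : ‖b‖ ≤ K) (n : ℕ) : ‖a ^ n - b ^ n‖ ≤ n * K ^ n * ‖a - b‖ := by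
  induction n with
  | zero => simp
  | succ n ih =>
    have e : a ^ (n + 1) - b ^ (n + 1) = a * (a ^ n - b ^ n) + (a - b) * b ^ n := by
      rw [pow_succ', pow_succ']; noncomm_ring
    have hK0 : 0 ≤ K := by linarith
    have hbn : ‖b ^ n‖ ≤ K ^ n :=
      (norm_pow_le b n).trans (pow_le_pow_left₀ (norm_nonneg _) hb n)
    calc ‖a ^ (n + 1) - b ^ (n + 1)‖
        ≤ ‖a‖ * ‖a ^ n - b ^ n‖ + ‖a - b‖ * ‖b ^ n‖ := by
          rw [e]
          exact (norm_add_le _ _).trans (add_le_add (norm_mul_le _ _) (norm_mul_le _ _))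
      _ ≤ K * (n * K ^ n * ‖a - b‖) + ‖a - b‖ * K ^ (n + 1) := by
          have : K ^ n ≤ K ^ (n + 1) := pow_le_pow_right₀ hK n.le_succ
          gcongr
          exact hbn.trans this
      _ = (n + 1 : ℕ) * K ^ (n + 1) * ‖a - b‖ := by push_cast; ring

variable [NormedAlgebra ℝ A] [CompleteSpace A]

theorem norm_exp_le (x : A) : ‖NormedSpace.exp x‖ ≤ Real.exp ‖x‖ := by
  rw [NormedSpace.exp_eq_tsum (𝕂 := ℝ), Real.exp_eq_exp_ℝ]
  refine tsum_of_norm_bounded (NormedSpace.exp_series_hasSum_exp' (𝕂 := ℝ) ‖x‖) fun n => ?_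
  rw [norm_smul, smul_eq_mul, Real.norm_of_nonneg (by positivity)]
  gcongr
  exact norm_pow_le x n

/-- A family tangent to `exp (h • G)` at `h = 0` and of exponential growth has
`F (t / n) ^ n → exp (t • G)`. -/
theorem tendsto_pow_exp_of_hasDerivAt {F : ℝ → A} {G : A} {c : ℝ} (hF0 : F 0 = 1)
    (hF : HasDerivAt F G 0) (hc : 0 ≤ c)
    (hbound : ∀ h, 0 ≤ h → h ≤ 1 → ‖F h‖ ≤ Real.exp (c * h)) {t : ℝ} (ht : 0 ≤ t) :
    Tendsto (fun n : ℕ => F (t / n) ^ n) atTop (𝓝 (NormedSpace.exp (t • G))) := by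
  let _ : NormedAlgebra ℚ A := NormedAlgebra.restrictScalars ℚ ℝ A
  -- With this rate, `F h` and `exp (h • G)` are both bounded by `exp (K h)` for `0 ≤ h ≤ 1`, so at
  -- `h = t / n` their `n`-th powers stay below `exp (K t)`, uniformly in `n`.
  set K := c + ‖G‖ with hK
  set D : ℝ → A := fun h => F h - NormedSpace.exp (h • G) with hD
  have hDd : HasDerivAt D 0 0 := by
    have h1 := hF.fun_sub (hasDerivAt_exp_smul_const (𝕂 := ℝ) G 0)
    rw [zero_smul, NormedSpace.exp_zero, one_mul, sub_self] at h1
    exact h1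
  have hD0 : D 0 = 0 := by simp [hD, hF0]
  have hlim0 : Tendsto (fun n : ℕ => t / n) atTop (𝓝 0) := tendsto_const_div_atTop_nhds_zero_nat t
  have ho : (fun n : ℕ => D (t / n)) =o[atTop] fun n : ℕ => t / n := by
    have := hasDerivAt_iff_isLittleO.1 hDd
    simp only [hD0, sub_zero, smul_zero] at this
    exact this.comp_tendsto hlim0
  have hmul : Tendsto (fun n : ℕ => (n : ℝ) * ‖D (t / n)‖) atTop (𝓝 0) := by
    have h1 : (fun n : ℕ => (n : ℝ) * ‖D (t / n)‖) =o[atTop] fun n : ℕ => (n : ℝ) * (t / n) :=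
      (Asymptotics.isBigO_refl _ _).mul_isLittleO ho.norm_left
    have h2 : (fun n : ℕ => (n : ℝ) * (t / n)) =O[atTop] fun _ => (1 : ℝ) := by
      refine Asymptotics.IsBigO.of_bound t ?_
      filter_upwards [eventually_gt_atTop 0] with n hn
      have : (n : ℝ) ≠ 0 := by positivity
      rw [mul_div_cancel₀ _ this]
      simp [abs_of_nonneg ht]
    exact (Asymptotics.isLittleO_one_iff ℝ).1 (h1.trans_isBigO h2)
  have hle1 : ∀ᶠ n : ℕ in atTop, t / n ≤ 1 := hlim0.eventually_le_const one_pos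
  have key : ∀ᶠ n : ℕ in atTop, ‖F (t / n) ^ n - NormedSpace.exp (t • G)‖ ≤
      Real.exp (K * t) * ((n : ℝ) * ‖D (t / n)‖) := by
    filter_upwards [hle1, eventually_gt_atTop 0] with n hn hn0
    have hn' : (n : ℝ) ≠ 0 := by positivity
    have hh : 0 ≤ t / n := by positivity
    have e1 : NormedSpace.exp (t • G) = NormedSpace.exp ((t / n) • G) ^ n := by
      rw [← NormedSpace.exp_nsmul, ← Nat.cast_smul_eq_nsmul ℝ, smul_smul, mul_div_cancel₀ _ hn']
    have e2 : Real.exp (K * t) = Real.exp (K * (t / n)) ^ n := by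
      rw [← Real.exp_nat_mul]; congr 1; field_simp
    have hG := norm_nonneg G
    have b1 : ‖F (t / n)‖ ≤ Real.exp (K * (t / n)) :=
      (hbound _ hh hn).trans (Real.exp_le_exp.2 (by gcongr; linarith))
    have b2 : ‖NormedSpace.exp ((t / n) • G)‖ ≤ Real.exp (K * (t / n)) := by
      refine (norm_exp_le _).trans (Real.exp_le_exp.2 ?_)
      rw [norm_smul, Real.norm_of_nonneg hh, mul_comm]
      gcongr
      linarith
    have := norm_pow_sub_pow_le_of_norm_le
      (Real.one_le_exp (by positivity : 0 ≤ K * (t / n))) b1 b2 n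
    rw [e1, e2]
    refine this.trans (le_of_eq ?_)
    simp only [hD]; ring
  rw [tendsto_iff_norm_sub_tendsto_zero]
  refine squeeze_zero' (Eventually.of_forall fun _ => norm_nonneg _) key ?_
  simpa using hmul.const_mul (Real.exp (K * t))

end Chernoff

/-! ### The Lindblad semigroup preserves states -/

section Positivity

set_option linter.unusedSectionVars false

variable {V : Type*} [NormedAddCommGroup V] [InnerProductSpace ℂ V] [CompleteSpace V]
  [FiniteDimensional ℂ V]

/-- The non-selfadjoint Hamiltonian `-(i/ħ) H - ½ ∑ₖ Lₖ† Lₖ`. -/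
def driftOperator (hbar : ℝ) (H : V →L[ℂ] V) {p : ℕ} (L : Fin p → V →L[ℂ] V) : V →L[ℂ] V :=
  -(Complex.I / (hbar : ℂ)) • H - (1 / 2 : ℂ) • ∑ k, (L k).adjoint * L k

theorem adjoint_driftOperator (hbar : ℝ) {H : V →L[ℂ] V} (hH : IsSelfAdjoint H) {p : ℕ}
    (L : Fin p → V →L[ℂ] V) : (driftOperator hbar H L).adjoint =
      (Complex.I / (hbar : ℂ)) • H - (1 / 2 : ℂ) • ∑ k, (L k).adjoint * L k := by
  rw [← ContinuousLinearMap.star_eq_adjoint, driftOperator, star_sub, star_smul, star_smul,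
    hH.star_eq, star_sum]
  simp [← ContinuousLinearMap.star_eq_adjoint, neg_div]

theorem lindblad_apply (hbar : ℝ) {H : V →L[ℂ] V} (hH : IsSelfAdjoint H) {p : ℕ}
    (L : Fin p → V →L[ℂ] V) (X : V →L[ℂ] V) :
    lindblad hbar H L X = driftOperator hbar H L * X + X * (driftOperator hbar H L).adjoint +
      ∑ k, L k * X * (L k).adjoint := by
  rw [adjoint_driftOperator hbar hH, driftOperator]
  change -(Complex.I / (hbar : ℂ)) • (H * X - X * H) + ∑ k, (L k * X * (L k).adjoint -
      (1 / 2 : ℂ) • ((L k).adjoint * L k * X + X * ((L k).adjoint * L k))) = _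
  simp only [sub_mul, mul_sub, smul_mul_assoc, mul_smul_comm, Finset.sum_mul, Finset.mul_sum,
    Finset.sum_sub_distrib, ← Finset.smul_sum, Finset.sum_add_distrib]
  module

theorem isClosed_isPositive : IsClosed {X : V →L[ℂ] V | X.IsPositive} := by
  have : {X : V →L[ℂ] V | X.IsPositive} = {X | 0 ≤ X} := by
    ext X; exact (ContinuousLinearMap.nonneg_iff_isPositive X).symm
  rw [this]
  exact isClosed_Ici

theorem isPositive_mul_mul_adjoint {X : V →L[ℂ] V} (hX : X.IsPositive) (K : V →L[ℂ] V) :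
    (K * X * K.adjoint).IsPositive := by
  have := hX.conj_adjoint K
  rwa [← ContinuousLinearMap.comp_assoc] at this

/-- The second-order term completes the Euler step to `(1 + hK) X (1 + hK)† + h ∑ Lₖ X Lₖ†`, with
`K` the drift; this is manifestly positive, and the tangent at `h = 0` is unchanged. -/
theorem IsPositive.lindblad_euler (hbar : ℝ) {H : V →L[ℂ] V} (hH : IsSelfAdjoint H) {p : ℕ}
    (L : Fin p → V →L[ℂ] V) {X : V →L[ℂ] V} (hX : X.IsPositive) {h : ℝ} (hh : 0 ≤ h) :
    (X + h • lindblad hbar H L X + h ^ 2 •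
      (driftOperator hbar H L * X * (driftOperator hbar H L).adjoint)).IsPositive := by
  set G := driftOperator hbar H L with hG
  have ha : (1 + h • G).adjoint = 1 + h • G.adjoint := by
    rw [← ContinuousLinearMap.star_eq_adjoint, ← ContinuousLinearMap.star_eq_adjoint, star_add,
      star_smul, star_one, star_trivial h]
  have e : X + h • lindblad hbar H L X + h ^ 2 • (G * X * G.adjoint) =
      (1 + h • G) * X * (1 + h • G).adjoint + ∑ k, h • (L k * X * (L k).adjoint) := by
    rw [lindblad_apply hbar hH, ha, ← Finset.smul_sum]
    generalize ∑ k, L k * X * (L k).adjoint = Y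
    simp only [add_mul, mul_add, smul_mul_assoc, mul_smul_comm, one_mul, mul_one, mul_assoc]
    module
  rw [e]
  refine ContinuousLinearMap.IsPositive.add (isPositive_mul_mul_adjoint hX _)
    (ContinuousLinearMap.isPositive_sum _ fun k _ => ?_)
  have := (isPositive_mul_mul_adjoint hX (L k)).smul_of_nonneg (c := (h : ℂ))
    (by exact_mod_cast hh)
  rwa [Complex.coe_smul] at this

theorem IsPositive.evolution_lindblad (hbar : ℝ) {H : V →L[ℂ] V} (hH : IsSelfAdjoint H) {p : ℕ}
    (L : Fin p → V →L[ℂ] V) {X : V →L[ℂ] V} (hX : X.IsPositive) {t : ℝ} (ht : 0 ≤ t) :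
    (evolution (lindblad hbar H L) t X).IsPositive := by
  -- The growth bound uses `‖1‖ = 1`, which fails on the zero space.
  rcases subsingleton_or_nontrivial V with hV | hV
  · rw [Subsingleton.elim (evolution (lindblad hbar H L) t X) 0]
    exact ContinuousLinearMap.isPositive_zero
  set D := driftOperator hbar H L with hD
  set G := lindblad hbar H L with hG
  set C : (V →L[ℂ] V) →L[ℂ] (V →L[ℂ] V) :=
    ContinuousLinearMap.mulLeftRight ℂ (V →L[ℂ] V) D D.adjoint with hC
  set F : ℝ → (V →L[ℂ] V) →L[ℂ] (V →L[ℂ] V) := fun h => 1 + h • G + h ^ 2 • C with hF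
  have hFpos : ∀ h : ℝ, 0 ≤ h → ∀ Y : V →L[ℂ] V, Y.IsPositive → (F h Y).IsPositive :=
    fun h hh Y hY => IsPositive.lindblad_euler hbar hH L hY hh
  have hFpow : ∀ h : ℝ, 0 ≤ h → ∀ n : ℕ, ((F h ^ n) X).IsPositive := by
    intro h hh n
    induction n with
    | zero => simpa using hX
    | succ n ih => rw [pow_succ']; exact hFpos h hh _ ih
  have hF0 : F 0 = 1 := by
    simp only [hF]
    rw [zero_pow two_ne_zero, zero_smul ℝ G, zero_smul ℝ C, add_zero, add_zero]
  have hFd : HasDerivAt F G 0 := by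
    have h1 : HasDerivAt (fun h : ℝ => h • G) G 0 := by
      have h := (hasDerivAt_id (0 : ℝ)).smul_const G
      rw [one_smul ℝ G] at h
      exact h
    have h2 : HasDerivAt (fun h : ℝ => h ^ 2 • C) 0 0 := by
      have h := (hasDerivAt_pow 2 (0 : ℝ)).smul_const C
      rw [pow_one, mul_zero, zero_smul ℝ C] at h
      exact h
    have h3 := (h1.const_add 1).fun_add h2
    rw [add_zero] at h3
    exact h3
  have hFb : ∀ h, 0 ≤ h → h ≤ 1 → ‖F h‖ ≤ Real.exp ((‖G‖ + ‖C‖) * h) := by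
    intro h h0 h1
    have b1 : ‖F h‖ ≤ 1 + h * ‖G‖ + h ^ 2 * ‖C‖ := by
      refine (norm_add₃_le).trans ?_
      rw [norm_one, norm_smul, norm_smul, Real.norm_of_nonneg h0, Real.norm_of_nonneg (by positivity)]
    have b2 : h ^ 2 * ‖C‖ ≤ h * ‖C‖ := by
      gcongr; nlinarith
    have b3 := Real.add_one_le_exp ((‖G‖ + ‖C‖) * h)
    linarith
  have hlim := tendsto_pow_exp_of_hasDerivAt hF0 hFd (by positivity) hFb ht
  have hlim' : Tendsto (fun n : ℕ => (F (t / n) ^ n) X) atTop (𝓝 (evolution G t X)) :=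
    ((ContinuousLinearMap.apply ℂ (V →L[ℂ] V) X).continuous.tendsto _).comp hlim
  exact isClosed_isPositive.mem_of_tendsto hlim'
    (Eventually.of_forall fun n => hFpow _ (by positivity) n)

theorem hasDerivAt_evolution {E : Type*} [NormedAddCommGroup E] [NormedSpace ℂ E]
    [CompleteSpace E] (G : E →L[ℂ] E) (x : E) (t : ℝ) :
    HasDerivAt (fun s => evolution G s x) (G (evolution G t x)) t :=
  (((ContinuousLinearMap.apply ℂ E x).restrictScalars ℝ).hasFDerivAt.comp_hasDerivAt t
    (hasDerivAt_exp_smul_const' (𝕂 := ℝ) G t))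

@[simp]
theorem evolution_zero {E : Type*} [NormedAddCommGroup E] [NormedSpace ℂ E]
    (G : E →L[ℂ] E) (x : E) : evolution G 0 x = x := by
  simp [evolution]

/-- The trace as a bounded functional on operators. -/
def traceCLM (V : Type*) [NormedAddCommGroup V] [InnerProductSpace ℂ V]
    [FiniteDimensional ℂ V] : (V →L[ℂ] V) →L[ℂ] ℂ :=
  LinearMap.toContinuousLinearMap
    (LinearMap.trace ℂ V ∘ₗ ContinuousLinearMap.coeLM ℂ)

@[simp]
theorem traceCLM_apply (X : V →L[ℂ] V) :
    traceCLM V X = LinearMap.trace ℂ V (X : V →ₗ[ℂ] V) := rfl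

theorem traceCLM_mul_comm (X Y : V →L[ℂ] V) : traceCLM V (X * Y) = traceCLM V (Y * X) :=
  LinearMap.trace_mul_comm ℂ (X : V →ₗ[ℂ] V) (Y : V →ₗ[ℂ] V)

theorem traceCLM_lindblad (hbar : ℝ) (H : V →L[ℂ] V) {p : ℕ} (L : Fin p → V →L[ℂ] V)
    (X : V →L[ℂ] V) : traceCLM V (lindblad hbar H L X) = 0 := by
  change traceCLM V (-(Complex.I / (hbar : ℂ)) • (H * X - X * H) + ∑ k, (L k * X * (L k).adjoint -
      (1 / 2 : ℂ) • ((L k).adjoint * L k * X + X * ((L k).adjoint * L k)))) = _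
  rw [map_add, map_smul, map_sub, traceCLM_mul_comm H X, sub_self, smul_zero, zero_add, map_sum]
  refine Finset.sum_eq_zero fun k _ => ?_
  rw [map_sub, map_smul, map_add, traceCLM_mul_comm X, traceCLM_mul_comm (L k * X), ← mul_assoc,
    smul_eq_mul]
  ring

theorem evolution_mem_densityOperators (hbar : ℝ) {H : V →L[ℂ] V} (hH : IsSelfAdjoint H) {p : ℕ}
    (L : Fin p → V →L[ℂ] V) {ρ : V →L[ℂ] V} (hρ : ρ ∈ densityOperators V) {t : ℝ} (ht : 0 ≤ t) :
    evolution (lindblad hbar H L) t ρ ∈ densityOperators V := by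
  refine ⟨IsPositive.evolution_lindblad hbar hH L hρ.1 ht, ?_⟩
  have hd : ∀ s, HasDerivAt (fun s => traceCLM V (evolution (lindblad hbar H L) s ρ)) 0 s := by
    intro s
    have := ((traceCLM V).restrictScalars ℝ).hasFDerivAt.comp_hasDerivAt s
      (hasDerivAt_evolution (lindblad hbar H L) ρ s)
    simp only [ContinuousLinearMap.coe_restrictScalars', traceCLM_lindblad] at this
    exact this
  have hc := is_const_of_deriv_eq_zero (fun s => (hd s).differentiableAt) (fun s => (hd s).deriv) t 0
  simpa using hc.trans (by simpa using hρ.2)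

/-- For a rank-one operator `u u†` norm and trace agree; a positive operator is a sum of these. -/
theorem norm_le_trace {X : V →L[ℂ] V} (hX : X.IsPositive) : ‖X‖ ≤ (traceCLM V X).re := by
  obtain ⟨m, u, rfl⟩ := ContinuousLinearMap.isPositive_iff_eq_sum_rankOne.1 hX
  rw [map_sum, Complex.re_sum]
  refine (norm_sum_le _ _).trans (Finset.sum_le_sum fun i _ => ?_)
  rw [traceCLM_apply, InnerProductSpace.trace_rankOne, InnerProductSpace.norm_rankOne,
    inner_self_eq_norm_sq_to_K]
  norm_cast
  rw [sq]
  exact (Complex.ofReal_re _).ge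

theorem isCompact_densityOperators : IsCompact (densityOperators V) := by
  have : ProperSpace (V →L[ℂ] V) := FiniteDimensional.proper ℂ _
  refine Metric.isCompact_of_isClosed_isBounded ?_ ?_
  · exact isClosed_isPositive.inter (isClosed_eq (traceCLM V).continuous continuous_const)
  · refine isBounded_iff_forall_norm_le.2 ⟨1, fun X hX => (norm_le_trace hX.1).trans ?_⟩
    rw [traceCLM_apply, hX.2, Complex.one_re]

theorem rankOne_mem_densityOperators {v : V} (hv : ‖v‖ = 1) :
    InnerProductSpace.rankOne ℂ v v ∈ densityOperators V := by
  refine ⟨InnerProductSpace.isPositive_rankOne_self v, ?_⟩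
  rw [InnerProductSpace.trace_rankOne, inner_self_eq_norm_sq_to_K, hv]
  simp

end Positivity

/-! ### Invariance and the block structure of the generator -/

section Blocks

set_option linter.unusedSectionVars false

variable {V : Type*} [NormedAddCommGroup V] [InnerProductSpace ℂ V] [CompleteSpace V]
  [FiniteDimensional ℂ V]

theorem rankOne_mem_statesOn {S : Submodule ℂ V} {v : V} (hv : ‖v‖ = 1) (hvS : v ∈ S) :
    InnerProductSpace.rankOne ℂ v v ∈ statesOn S := by
  refine ⟨rankOne_mem_densityOperators hv, ?_⟩
  have hP : S.starProjection v = v := Submodule.starProjection_eq_self_iff.2 hvS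
  ext x
  simp only [mul_apply_eq_comp, InnerProductSpace.rankOne_apply, map_smul, hP]
  rw [← Submodule.inner_starProjection_left_eq_right, hP]

/-- Compression to `S` fixes the trajectory for `t ≥ 0`, so both sides are its right derivative at
zero; negative times are not controlled. -/
theorem lindblad_compress_of_invariant {G : (V →L[ℂ] V) →L[ℂ] (V →L[ℂ] V)} {S : Submodule ℂ V}
    (hinv : IsInvariantSubspace G S) {ρ : V →L[ℂ] V} (hρ : ρ ∈ statesOn S) :
    S.starProjection * G ρ * S.starProjection = G ρ := by
  set C : (V →L[ℂ] V) →L[ℂ] (V →L[ℂ] V) :=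
    ContinuousLinearMap.mulLeftRight ℂ (V →L[ℂ] V) S.starProjection S.starProjection with hC
  have h1 : HasDerivAt (fun s => C (evolution G s ρ)) (C (G ρ)) 0 := by
    have := (C.restrictScalars ℝ).hasFDerivAt.comp_hasDerivAt (0 : ℝ) (hasDerivAt_evolution G ρ 0)
    rw [evolution_zero] at this
    exact this
  have h2 := hasDerivAt_evolution G ρ 0
  rw [evolution_zero] at h2
  have h3 : HasDerivWithinAt (fun s => evolution G s ρ) (C (G ρ)) (Set.Ici 0) 0 := by
    refine h1.hasDerivWithinAt.congr (fun s hs => ?_) ?_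
    · exact (hinv ρ hρ s hs).2.symm
    · exact (hinv ρ hρ 0 le_rfl).2.symm
  exact (uniqueDiffWithinAt_Ici (0 : ℝ)).eq_deriv _ h3 h2.hasDerivWithinAt

theorem mem_of_forall_orthogonal {S : Submodule ℂ V} {x : V}
    (h : ∀ w ∈ Sᗮ, inner ℂ w x = 0) : x ∈ S := by
  rw [← Submodule.orthogonal_orthogonal S]
  exact fun w hw => h w hw

/-- If the states on `S` are invariant under the Lindblad semigroup, then `S` is invariant under
the operators `Lₖ` and the drift operator. -/
theorem mem_of_isInvariantSubspace (hbar : ℝ) {H : V →L[ℂ] V} (hH : IsSelfAdjoint H) {p : ℕ}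
    (L : Fin p → V →L[ℂ] V) {S : Submodule ℂ V}
    (hinv : IsInvariantSubspace (lindblad hbar H L) S) {v : V} (hv : v ∈ S) :
    (∀ k, L k v ∈ S) ∧ driftOperator hbar H L v ∈ S := by
  suffices hunit : ∀ v ∈ S, ‖v‖ = 1 → (∀ k, L k v ∈ S) ∧ driftOperator hbar H L v ∈ S by
    rcases eq_or_ne v 0 with rfl | hv0
    · simp
    have hn : (‖v‖ : ℂ) ≠ 0 := by exact_mod_cast norm_ne_zero_iff.2 hv0
    have := hunit ((‖v‖ : ℂ)⁻¹ • v) (S.smul_mem _ hv) (by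
      rw [norm_smul, norm_inv, Complex.norm_real, norm_norm,
        inv_mul_cancel₀ (norm_ne_zero_iff.2 hv0)])
    simpa [S.smul_mem_iff (inv_ne_zero hn)] using this
  intro v hv hv1
  set K := driftOperator hbar H L with hK
  set D := lindblad hbar H L (InnerProductSpace.rankOne ℂ v v) with hD
  have hDP := lindblad_compress_of_invariant hinv (rankOne_mem_statesOn hv1 hv)
  rw [← hD] at hDP
  have hDx : ∀ x, D x = inner ℂ v x • K v + inner ℂ (K v) x • v +
      ∑ k, inner ℂ (L k v) x • L k v := by
    intro x
    rw [hD, lindblad_apply hbar hH]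
    simp [ContinuousLinearMap.adjoint_inner_right, hK]
  have hDS : ∀ x, D x ∈ S := fun x => by
    rw [← hDP]; exact Submodule.starProjection_apply_mem _ _
  -- For `w ⊥ S` the drift terms drop out of `⟨w, D w⟩ = 0`, leaving `∑ |⟨w, Lₖ v⟩|² = 0`.
  have hL : ∀ k, L k v ∈ S := by
    intro k
    refine mem_of_forall_orthogonal fun w hw => ?_
    have hvw : inner ℂ v w = 0 := hw v hv
    have hz : inner ℂ w (D w) = 0 := Submodule.inner_left_of_mem_orthogonal (hDS w) hw
    have hwv : inner ℂ w v = 0 := Submodule.inner_left_of_mem_orthogonal hv hw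
    rw [hDx, inner_add_right, inner_add_right, inner_smul_right, inner_smul_right, hvw, hwv,
      zero_mul, mul_zero, zero_add, zero_add, inner_sum] at hz
    have hz' : ∑ k, ‖inner ℂ w (L k v)‖ ^ 2 = 0 := by
      rw [← Complex.ofReal_inj, Complex.ofReal_zero, ← hz, Complex.ofReal_sum]
      refine Finset.sum_congr rfl fun k _ => ?_
      rw [inner_smul_right, ← inner_conj_symm (L k v) w, Complex.conj_mul']
      norm_cast
    have := (Finset.sum_eq_zero_iff_of_nonneg fun k _ => by positivity).1 hz' k (Finset.mem_univ k)
    simpa using this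
  refine ⟨hL, ?_⟩
  -- Evaluating `D` at `v` itself isolates the drift: `D v` is `K v` plus a multiple of `v` plus a
  -- combination of the `L k v`.
  have h1 := hDS v
  rw [hDx, inner_self_eq_norm_sq_to_K, hv1] at h1
  have h2 : ∑ k, inner ℂ (L k v) v • L k v ∈ S :=
    S.sum_mem fun k _ => S.smul_mem _ (hL k)
  have h3 := (S.add_mem_iff_left h2).1 h1
  have h4 := (S.add_mem_iff_left (S.smul_mem _ hv)).1 h3
  simpa using h4

variable {S : Submodule ℂ V} {m r : ℕ} (bS : OrthonormalBasis (Fin m) ℂ S)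
  (bR : OrthonormalBasis (Fin r) ℂ Sᗮ)

theorem inner_eq_sum_blocks (x y : V) :
    inner ℂ x y = ∑ i, inner ℂ x (bS i : V) * inner ℂ (bS i : V) y +
      ∑ j, inner ℂ x (bR j : V) * inner ℂ (bR j : V) y := by
  conv_lhs => rw [← Submodule.starProjection_add_starProjection_orthogonal (K := S) y,
    bS.starProjection_eq_sum_rankOne, bR.starProjection_eq_sum_rankOne]
  simp [mul_comm]

include bS in
theorem inner_eq_sum_orthogonal {x : V} (hx : x ∈ Sᗮ) (y : V) :
    inner ℂ x y = ∑ j, inner ℂ x (bR j : V) * inner ℂ (bR j : V) y := by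
  rw [inner_eq_sum_blocks bS bR]
  simp [Submodule.inner_left_of_mem_orthogonal (bS _).2 hx]

/-- The block `X_R` as a linear map. -/
def blockRLinear : (V →L[ℂ] V) →ₗ[ℂ] Matrix (Fin r) (Fin r) ℂ where
  toFun := blockR bR
  map_add' X Y := by ext; simp [blockR]
  map_smul' c X := by ext; simp [blockR]

theorem blockR_adjoint (X : V →L[ℂ] V) : blockR bR X.adjoint = (blockR bR X)ᴴ := by
  ext i j
  simp [blockR, ContinuousLinearMap.adjoint_inner_right]

include bS in
-- Since `K` preserves `S`, its adjoint preserves `Sᗮ`, so no intermediate vector in `S` contributes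
-- to the product.
theorem blockR_mul {K : V →L[ℂ] V} (hK : ∀ v ∈ S, K v ∈ S) (X : V →L[ℂ] V) :
    blockR bR (K * X) = blockR bR K * blockR bR X := by
  ext i j
  simp only [blockR, of_apply, mul_apply, mul_apply_eq_comp]
  rw [← ContinuousLinearMap.adjoint_inner_left K, inner_eq_sum_orthogonal bS bR]
  · simp [ContinuousLinearMap.adjoint_inner_left]
  · intro v hv
    rw [ContinuousLinearMap.adjoint_inner_right]
    exact Submodule.inner_right_of_mem_orthogonal (hK v hv) (bR i).2

include bS in
theorem blockR_mul_adjoint {K : V →L[ℂ] V} (hK : ∀ v ∈ S, K v ∈ S) (X : V →L[ℂ] V) :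
    blockR bR (X * K.adjoint) = blockR bR X * (blockR bR K)ᴴ := by
  have e : X * K.adjoint = (K * X.adjoint).adjoint := by
    simp only [← ContinuousLinearMap.star_eq_adjoint, star_mul, star_star]
  rw [e, blockR_adjoint, blockR_mul bS bR hK, blockR_adjoint, conjTranspose_mul,
    conjTranspose_conjTranspose]

/-- This is where the blocks `L_P` enter the reduced generator: `K` may carry `Sᗮ` into `S`, and
`K†` brings it back. -/
theorem blockR_adjoint_mul_self (K : V →L[ℂ] V) :
    blockR bR (K.adjoint * K) =
      (blockP bS bR K)ᴴ * blockP bS bR K + (blockR bR K)ᴴ * blockR bR K := by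
  ext i j
  simp only [blockR, blockP, of_apply, Matrix.add_apply, mul_apply, mul_apply_eq_comp,
    conjTranspose_apply, ContinuousLinearMap.adjoint_inner_right]
  rw [inner_eq_sum_blocks bS bR]
  simp

/-- The reduced generator as a map on matrices. -/
theorem reducedGenerator_mulVec_vec (hbar : ℝ) {p : ℕ} (HR : Matrix (Fin r) (Fin r) ℂ)
    (LR : Fin p → Matrix (Fin r) (Fin r) ℂ) (LP : Fin p → Matrix (Fin m) (Fin r) ℂ)
    (X : Matrix (Fin r) (Fin r) ℂ) :
    reducedGenerator hbar HR LR LP *ᵥ X.vec =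
      (-(Complex.I / (hbar : ℂ)) • (HR * X - X * HR) + ∑ k, LR k * X * (LR k)ᴴ
        - (1 / 2 : ℂ) • ((∑ k, ((LP k)ᴴ * LP k + (LR k)ᴴ * LR k)) * X)
        - (1 / 2 : ℂ) • (X * ∑ k, ((LP k)ᴴ * LP k + (LR k)ᴴ * LR k))).vec := by
  have e1 : ∀ {n : ℕ} (M : Matrix (Fin n) (Fin r) ℂ), (Mᵀ * M.map star)ᵀ = Mᴴ * M := by
    intro n M
    rw [transpose_mul, transpose_transpose]
    rfl
  have e2 : ∀ M : Matrix (Fin r) (Fin r) ℂ, (M.map star)ᵀ = Mᴴ := fun M => rfl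
  simp only [reducedGenerator, sub_mulVec, add_mulVec, smul_mulVec, sum_mulVec,
    kronecker_mulVec_vec, vec_sub, vec_add, vec_smul, vec_sum, transpose_one, Matrix.mul_one,
    Matrix.one_mul, transpose_transpose, transpose_add, e1, e2, Finset.sum_mul, Finset.mul_sum]

theorem vec_blockR_lindblad (hbar : ℝ) {H : V →L[ℂ] V} (hH : IsSelfAdjoint H) {p : ℕ}
    (L : Fin p → V →L[ℂ] V) (hinv : IsInvariantSubspace (lindblad hbar H L) S)
    (X : V →L[ℂ] V) :
    (blockR bR (lindblad hbar H L X)).vec =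
      reducedGenerator hbar (blockR bR H) (fun k => blockR bR (L k))
        (fun k => blockP bS bR (L k)) *ᵥ (blockR bR X).vec := by
  have hinv' := fun v hv => mem_of_isInvariantSubspace hbar hH L hinv (v := v) hv
  have hHR : (blockR bR H)ᴴ = blockR bR H := by
    rw [← blockR_adjoint, ← ContinuousLinearMap.star_eq_adjoint, hH.star_eq]
  have hK : blockR bR (driftOperator hbar H L) = -(Complex.I / (hbar : ℂ)) • blockR bR H -
      (1 / 2 : ℂ) • ∑ k, ((blockP bS bR (L k))ᴴ * blockP bS bR (L k) +
        (blockR bR (L k))ᴴ * blockR bR (L k)) := by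
    simp only [← blockR_adjoint_mul_self]
    change blockRLinear bR (driftOperator hbar H L) = _ • blockRLinear bR H -
      (1 / 2 : ℂ) • ∑ k, blockRLinear bR ((L k).adjoint * L k)
    rw [driftOperator, map_sub, map_smul, map_smul, map_sum]
  have hKa : blockR bR (driftOperator hbar H L).adjoint = (Complex.I / (hbar : ℂ)) • blockR bR H -
      (1 / 2 : ℂ) • ∑ k, ((blockP bS bR (L k))ᴴ * blockP bS bR (L k) +
        (blockR bR (L k))ᴴ * blockR bR (L k)) := by
    simp only [← blockR_adjoint_mul_self]
    change blockRLinear bR _ = _ • blockRLinear bR H -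
      (1 / 2 : ℂ) • ∑ k, blockRLinear bR ((L k).adjoint * L k)
    rw [adjoint_driftOperator hbar hH, map_sub, map_smul, map_smul, map_sum]
  rw [reducedGenerator_mulVec_vec]
  congr 1
  have hsplit : blockR bR (lindblad hbar H L X) = blockR bR (driftOperator hbar H L * X) +
      blockR bR (X * (driftOperator hbar H L).adjoint) +
      ∑ k, blockR bR (L k * (X * (L k).adjoint)) := by
    rw [lindblad_apply hbar hH]
    simp only [mul_assoc]
    change blockRLinear bR _ = blockRLinear bR _ + blockRLinear bR _ + ∑ k, blockRLinear bR _
    rw [map_add, map_add, map_sum]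
  rw [hsplit, blockR_mul bS bR fun v hv => (hinv' v hv).2,
    blockR_mul_adjoint bS bR fun v hv => (hinv' v hv).2, ← blockR_adjoint, hK, hKa]
  have hLk : ∀ k, blockR bR (L k * (X * (L k).adjoint)) =
      blockR bR (L k) * blockR bR X * (blockR bR (L k))ᴴ := fun k => by
    rw [blockR_mul bS bR fun v hv => (hinv' v hv).1 k,
      blockR_mul_adjoint bS bR fun v hv => (hinv' v hv).1 k, Matrix.mul_assoc]
  simp only [hLk]
  generalize ∑ k, blockR bR (L k) * blockR bR X * (blockR bR (L k))ᴴ = Y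
  generalize ∑ k, ((blockP bS bR (L k))ᴴ * blockP bS bR (L k) +
        (blockR bR (L k))ᴴ * blockR bR (L k)) = Z
  simp only [Matrix.sub_mul, Matrix.mul_sub, Matrix.smul_mul, Matrix.mul_smul]
  module

theorem blockR_eq_zero_of_mem_statesOn {ρ : V →L[ℂ] V} (hρ : ρ ∈ statesOn S) :
    blockR bR ρ = 0 := by
  ext i j
  rw [← hρ.2]
  simp [blockR, (Submodule.starProjection_apply_eq_zero_iff S).2 (bR j).2]

/-- Writing `ρ = ∑ uₖ uₖ†`, the trace of the block is `∑ |⟨bᵢ, uₖ⟩|²`; its vanishing puts every `uₖ`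
in `S`. -/
theorem mem_statesOn_of_trace_blockR_eq_zero {ρ : V →L[ℂ] V} (hρ : ρ ∈ densityOperators V)
    (h : (blockR bR ρ).trace = 0) : ρ ∈ statesOn S := by
  refine ⟨hρ, ?_⟩
  obtain ⟨n, u, hu⟩ := ContinuousLinearMap.isPositive_iff_eq_sum_rankOne.1 hρ.1
  have h0 : ∑ i, ∑ k, ‖inner ℂ (bR i : V) (u k)‖ ^ 2 = 0 := by
    rw [← Complex.ofReal_inj, Complex.ofReal_zero, ← h, Matrix.trace, Complex.ofReal_sum]
    refine Finset.sum_congr rfl fun i _ => ?_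
    rw [diag_apply, blockR, of_apply, hu, _root_.sum_apply, inner_sum, Complex.ofReal_sum]
    refine Finset.sum_congr rfl fun k _ => ?_
    rw [InnerProductSpace.rankOne_apply, inner_smul_right, ← inner_conj_symm (u k),
      Complex.conj_mul']
    norm_cast
  have huS : ∀ k, u k ∈ S := by
    intro k
    refine mem_of_forall_orthogonal fun w hw => ?_
    have hi : ∀ i, inner ℂ (bR i : V) (u k) = 0 := by
      intro i
      have h1 := (Finset.sum_eq_zero_iff_of_nonneg fun i _ => by positivity).1 h0 i
        (Finset.mem_univ i)
      have h2 := (Finset.sum_eq_zero_iff_of_nonneg fun k _ => by positivity).1 h1 k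
        (Finset.mem_univ k)
      simpa using h2
    have hw' : w = ∑ i, inner ℂ (bR i) (⟨w, hw⟩ : Sᗮ) • (bR i : V) := by
      have := congrArg (Subtype.val) (bR.sum_repr' ⟨w, hw⟩)
      simpa using this.symm
    rw [hw', sum_inner]
    exact Finset.sum_eq_zero fun i _ => by rw [inner_smul_left, hi, mul_zero]
  have hP : ∀ k, S.starProjection (u k) = u k :=
    fun k => Submodule.starProjection_eq_self_iff.2 (huS k)
  rw [hu]
  ext x
  simp only [mul_apply_eq_comp, _root_.sum_apply, InnerProductSpace.rankOne_apply, map_sum,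
    map_smul, hP]
  refine Finset.sum_congr rfl fun k _ => ?_
  rw [← Submodule.inner_starProjection_left_eq_right, hP]

end Blocks

/-! ### Convergence criteria -/

section Analysis

/-- By the mean value theorem on `[0, t]` and monotonicity, `f t ≤ f c = (g t - g 0) / t ≤ 2C / t`.
-/
theorem tendsto_zero_of_antitoneOn_of_bounded_primitive {f g : ℝ → ℝ} {C : ℝ}
    (hg : ∀ s, HasDerivAt g (f s) s) (hf : AntitoneOn f (Set.Ici 0))
    (hf0 : ∀ s, 0 ≤ s → 0 ≤ f s) (hC : ∀ s, 0 ≤ s → |g s| ≤ C) :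
    Tendsto f atTop (𝓝 0) := by
  have hb : ∀ᶠ t in atTop, f t ≤ 2 * C / t := by
    filter_upwards [eventually_gt_atTop 0] with t ht
    obtain ⟨c, hc, hcs⟩ := exists_hasDerivAt_eq_slope g f ht
      (fun s _ => (hg s).continuousAt.continuousWithinAt) (fun s _ => hg s)
    have h1 : f t ≤ f c := hf hc.1.le ht.le hc.2.le
    have h2 := abs_le.1 (hC t ht.le)
    have h3 := abs_le.1 (hC 0 le_rfl)
    rw [hcs, sub_zero] at h1
    refine h1.trans ?_
    gcongr
    linarith
  refine squeeze_zero' ?_ hb (tendsto_const_nhds.div_atTop tendsto_id)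
  filter_upwards [eventually_ge_atTop 0] with t ht using hf0 t ht

/-- On the compact set `K ∩ {D ≥ ε}` the minimum of `f` is positive, so small `f` forces `D < ε`.
Values in `ENNReal` allow `D` to be the distance to an empty set, as happens for `S = 0`. -/
theorem _root_.IsCompact.tendsto_zero_of_tendsto_zero {X : Type*} [TopologicalSpace X] {K : Set X}
    (hK : IsCompact K) {D : X → ENNReal} (hD : Continuous D) {f : X → ℝ} (hf : Continuous f)
    (hfD : ∀ x ∈ K, f x ≤ 0 → D x = 0) {ι : Type*} {l : Filter ι} {x : ι → X}
    (hx : ∀ᶠ i in l, x i ∈ K) (hfx : Tendsto (fun i => f (x i)) l (𝓝 0)) :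
    Tendsto (fun i => D (x i)) l (𝓝 0) := by
  rw [ENNReal.tendsto_nhds_zero]
  intro ε hε
  have hKε : IsCompact (K ∩ {y | ε ≤ D y}) := hK.inter_right (isClosed_le continuous_const hD)
  rcases (K ∩ {y | ε ≤ D y}).eq_empty_or_nonempty with he | hne
  · filter_upwards [hx] with i hi
    by_contra! h
    exact (he ▸ (⟨hi, h.le⟩ : x i ∈ K ∩ {y | ε ≤ D y}) : x i ∈ (∅ : Set X))
  · obtain ⟨y, hy, hmin⟩ := hKε.exists_isMinOn hne hf.continuousOn
    have hfy : 0 < f y := by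
      by_contra! h
      have h1 := hfD y hy.1 h
      have h2 : ε ≤ D y := hy.2
      rw [h1] at h2
      exact absurd hε (not_lt.2 h2)
    filter_upwards [hx, hfx.eventually_lt_const hfy] with i hi hi'
    by_contra! h
    exact absurd (hmin (⟨hi, h.le⟩ : x i ∈ K ∩ {y | ε ≤ D y})) (not_le.2 hi')

theorem tendsto_zero_of_tendsto_infEDist {E F : Type*} [NormedAddCommGroup E] [NormedSpace ℂ E]
    [NormedAddCommGroup F] [NormedSpace ℂ F] (φ : E →L[ℂ] F) {W : Set E}
    (hW : ∀ x ∈ W, φ x = 0) {ι : Type*} {l : Filter ι} {x : ι → E}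
    (hx : Tendsto (fun i => Metric.infEDist (x i) W) l (𝓝 0)) :
    Tendsto (fun i => φ (x i)) l (𝓝 0) := by
  rw [Metric.tendsto_nhds]
  intro ε hε
  have hδ : 0 < ε / (‖φ‖ + 1) := by positivity
  filter_upwards [hx.eventually_lt_const (ENNReal.ofReal_pos.2 hδ)] with i hi
  obtain ⟨y, hy, hxy⟩ := Metric.infEDist_lt_iff.1 hi
  rw [edist_lt_ofReal, dist_eq_norm] at hxy
  rw [dist_zero_right, ← sub_zero (φ (x i)), ← hW y hy, ← map_sub]
  calc ‖φ (x i - y)‖ ≤ ‖φ‖ * ‖x i - y‖ := φ.le_opNorm _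
    _ ≤ (‖φ‖ + 1) * ‖x i - y‖ := by gcongr; linarith
    _ < (‖φ‖ + 1) * (ε / (‖φ‖ + 1)) := by gcongr
    _ = ε := by field_simp

end Analysis

/-! ### Trace decay, conserved functionals and the two implications -/

section Main

open scoped ComplexOrder

set_option linter.unusedSectionVars false

variable {V : Type*} [NormedAddCommGroup V] [InnerProductSpace ℂ V] [CompleteSpace V]
  [FiniteDimensional ℂ V] {S : Submodule ℂ V} {m r : ℕ} (bS : OrthonormalBasis (Fin m) ℂ S)
  (bR : OrthonormalBasis (Fin r) ℂ Sᗮ)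

/-- The vectorization of the block `X_R`, as a bounded linear map. -/
def vecBlockR : (V →L[ℂ] V) →L[ℂ] (Fin r × Fin r → ℂ) :=
  LinearMap.toContinuousLinearMap
    { toFun := fun X => (blockR bR X).vec
      map_add' := fun X Y => by rw [← vec_add]; exact congrArg vec ((blockRLinear bR).map_add X Y)
      map_smul' := fun c X => by
        rw [RingHom.id_apply, ← vec_smul]; exact congrArg vec ((blockRLinear bR).map_smul c X) }

theorem vecBlockR_apply (X : V →L[ℂ] V) : vecBlockR bR X = (blockR bR X).vec := rfl

/-- The bounded linear functional `v ↦ w ⬝ᵥ v`. -/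
def dotProductCLM {n : Type*} [Fintype n] (w : n → ℂ) : (n → ℂ) →L[ℂ] ℂ :=
  LinearMap.toContinuousLinearMap
    { toFun := fun v => w ⬝ᵥ v
      map_add' := dotProduct_add w
      map_smul' := fun c v => dotProduct_smul c w v }

theorem hasDerivAt_clm_evolution {E F : Type*} [NormedAddCommGroup E] [NormedSpace ℂ E]
    [CompleteSpace E] [NormedAddCommGroup F] [NormedSpace ℂ F] (φ : E →L[ℂ] F) (G : E →L[ℂ] E)
    (x : E) (t : ℝ) :
    HasDerivAt (fun s => φ (evolution G s x)) (φ (G (evolution G t x))) t :=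
  (φ.restrictScalars ℝ).hasFDerivAt.comp_hasDerivAt t (hasDerivAt_evolution G x t)

theorem vec_one_dotProduct_vec (X : Matrix (Fin r) (Fin r) ℂ) :
    (1 : Matrix (Fin r) (Fin r) ℂ).vec ⬝ᵥ X.vec = X.trace := by
  rw [vec_dotProduct_vec, transpose_one, Matrix.one_mul]

theorem posSemidef_blockR {X : V →L[ℂ] V} (hX : X.IsPositive) : (blockR bR X).PosSemidef := by
  obtain ⟨n, u, rfl⟩ := ContinuousLinearMap.isPositive_iff_eq_sum_rankOne.1 hX
  have e : blockR bR (∑ k, InnerProductSpace.rankOne ℂ (u k) (u k)) =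
      ∑ k, vecMulVec (fun i => inner ℂ (bR i : V) (u k))
        (star fun i => inner ℂ (bR i : V) (u k)) := by
    ext i j
    simp [blockR, Matrix.sum_apply, vecMulVec_apply, mul_comm]
  rw [e]
  exact posSemidef_sum _ fun k _ => posSemidef_vecMulVec_self_star _

include bS in
/-- The probability of finding the state in `Sᗮ` does not increase. -/
theorem re_trace_blockR_lindblad_nonpos (hbar : ℝ) {H : V →L[ℂ] V} (hH : IsSelfAdjoint H) {p : ℕ}
    (L : Fin p → V →L[ℂ] V) (hinv : IsInvariantSubspace (lindblad hbar H L) S)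
    {X : V →L[ℂ] V} (hX : X.IsPositive) : (blockR bR (lindblad hbar H L X)).trace.re ≤ 0 := by
  have h := vec_blockR_lindblad bS bR hbar hH L hinv X
  rw [reducedGenerator_mulVec_vec, vec_inj] at h
  -- Under the trace the Hamiltonian and `L_R` terms cancel; what remains is the probability flow
  -- from `Sᗮ` into `S`.
  have ht : (blockR bR (lindblad hbar H L X)).trace =
      -∑ k, (blockP bS bR (L k) * blockR bR X * (blockP bS bR (L k))ᴴ).trace := by
    have e : ∀ {n : ℕ} (B : Matrix (Fin n) (Fin r) ℂ),
        (B * blockR bR X * Bᴴ).trace = (Bᴴ * B * blockR bR X).trace := fun B => by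
      rw [Matrix.trace_mul_comm, Matrix.mul_assoc]
    rw [h]
    simp only [trace_sub, trace_add, trace_smul, trace_sum, e,
      Matrix.trace_mul_comm (blockR bR X), Matrix.sum_mul, Matrix.add_mul,
      Finset.sum_add_distrib, smul_eq_mul]
    ring
  rw [ht, Complex.neg_re, Complex.re_sum, neg_nonpos]
  refine Finset.sum_nonneg fun k _ => ?_
  exact (Complex.nonneg_iff.1
    ((posSemidef_blockR bR hX).mul_mul_conjTranspose_same (blockP bS bR (L k))).trace_nonneg).1

/-- Pure states suffice: on them the functional is the quadratic form of an operator with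
coefficients `w`, and over `ℂ` a vanishing quadratic form kills the operator. -/
theorem eq_zero_of_dotProduct_vecBlockR_eq_zero {w : Fin r × Fin r → ℂ}
    (hw : ∀ ρ ∈ densityOperators V, w ⬝ᵥ vecBlockR bR ρ = 0) : w = 0 := by
  set T : V →ₗ[ℂ] V := ∑ q : Fin r × Fin r,
    w q • (InnerProductSpace.rankOne ℂ (bR q.1 : V) (bR q.2 : V) : V →ₗ[ℂ] V) with hT
  have hTv : ∀ x y, inner ℂ x (T y) =
      ∑ q, w q * (inner ℂ (bR q.2 : V) y * inner ℂ x (bR q.1 : V)) := by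
    intro x y
    simp [hT]
  have hunit : ∀ v : V, ‖v‖ = 1 → inner ℂ v (T v) = 0 := by
    intro v hv
    rw [hTv, ← hw _ (rankOne_mem_densityOperators hv)]
    simp [dotProduct, vecBlockR_apply, vec, blockR, mul_comm]
  have hT0 : T = 0 := by
    refine (inner_map_self_eq_zero T).1 fun v => ?_
    rw [← inner_conj_symm, map_eq_zero]
    rcases eq_or_ne v 0 with rfl | hv
    · simp
    have hn : (‖v‖ : ℂ) ≠ 0 := by exact_mod_cast norm_ne_zero_iff.2 hv
    have h1 := hunit ((‖v‖ : ℂ)⁻¹ • v) (by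
      rw [norm_smul, norm_inv, Complex.norm_real, norm_norm,
        inv_mul_cancel₀ (norm_ne_zero_iff.2 hv)])
    rw [map_smul, inner_smul_left, inner_smul_right] at h1
    simpa [hn] using h1
  have hb : ∀ i j, inner ℂ (bR i : V) (bR j : V) = if i = j then (1 : ℂ) else 0 := fun i j => by
    rw [← Submodule.coe_inner]; exact orthonormal_iff_ite.1 bR.orthonormal i j
  funext ⟨a, b⟩
  have h := hTv (bR a) (bR b)
  simp only [hb, Fintype.sum_prod_type] at h
  simpa [hT0] using h.symm

/-- Attractivity forces the reduced generator to be invertible. -/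
theorem det_reducedGenerator_ne_zero_of_isAttractive (hbar : ℝ) {H : V →L[ℂ] V}
    (hH : IsSelfAdjoint H) {p : ℕ} (L : Fin p → V →L[ℂ] V)
    (hinv : IsInvariantSubspace (lindblad hbar H L) S)
    (hattr : IsAttractiveSubspace (lindblad hbar H L) S) :
    (reducedGenerator hbar (blockR bR H) (fun k => blockR bR (L k))
      (fun k => blockP bS bR (L k))).det ≠ 0 := by
  intro hdet
  -- A left null vector, not an eigenvector, is the useful witness: it defines a conserved quantity.
  obtain ⟨w, hw0, hw⟩ := exists_vecMul_eq_zero_iff.2 hdet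
  refine hw0 (eq_zero_of_dotProduct_vecBlockR_eq_zero bR fun ρ hρ => ?_)
  set φ := (dotProductCLM w).comp (vecBlockR bR) with hφ
  have hφL : ∀ X, φ (lindblad hbar H L X) = 0 := fun X => by
    change w ⬝ᵥ (blockR bR (lindblad hbar H L X)).vec = 0
    rw [vec_blockR_lindblad bS bR hbar hH L hinv, dotProduct_mulVec, hw, zero_dotProduct]
  have hd : ∀ s, HasDerivAt (fun s => φ (evolution (lindblad hbar H L) s ρ)) 0 s := fun s => by
    simpa only [hφL] using hasDerivAt_clm_evolution φ (lindblad hbar H L) ρ s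
  have hconst : ∀ s, φ (evolution (lindblad hbar H L) s ρ) = φ ρ := fun s => by
    have := is_const_of_deriv_eq_zero (fun s => (hd s).differentiableAt) (fun s => (hd s).deriv) s 0
    rwa [evolution_zero] at this
  have hlim := tendsto_zero_of_tendsto_infEDist φ (fun τ hτ => by
    change w ⬝ᵥ (blockR bR τ).vec = 0
    rw [blockR_eq_zero_of_mem_statesOn bR hτ, vec_zero, dotProduct_zero]) (hattr ρ hρ)
  simp only [hconst] at hlim
  exact tendsto_nhds_unique tendsto_const_nhds hlim

/-- If the reduced generator is invertible, then an invariant subspace is attractive. -/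
theorem isAttractive_of_det_reducedGenerator_ne_zero (hbar : ℝ) {H : V →L[ℂ] V}
    (hH : IsSelfAdjoint H) {p : ℕ} (L : Fin p → V →L[ℂ] V)
    (hinv : IsInvariantSubspace (lindblad hbar H L) S)
    (hdet : (reducedGenerator hbar (blockR bR H) (fun k => blockR bR (L k))
      (fun k => blockP bS bR (L k))).det ≠ 0) :
    IsAttractiveSubspace (lindblad hbar H L) S := by
  intro ρ hρ
  set A := reducedGenerator hbar (blockR bR H) (fun k => blockR bR (L k))
      (fun k => blockP bS bR (L k)) with hA
  set G := lindblad hbar H L with hG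
  set τ : (V →L[ℂ] V) →L[ℂ] ℂ :=
    (dotProductCLM (1 : Matrix (Fin r) (Fin r) ℂ).vec).comp (vecBlockR bR)
  -- Chosen so that `γ ∘ G = τ`: along a trajectory, `γ` is a primitive of the trace of the
  -- `R`-block.
  set γ : (V →L[ℂ] V) →L[ℂ] ℂ :=
    (dotProductCLM ((1 : Matrix (Fin r) (Fin r) ℂ).vec ᵥ* A⁻¹)).comp (vecBlockR bR)
  have hτ : ∀ X, τ X = (blockR bR X).trace := fun X => vec_one_dotProduct_vec _
  have hγ : ∀ X, γ (G X) = τ X := fun X => by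
    change ((1 : Matrix (Fin r) (Fin r) ℂ).vec ᵥ* A⁻¹) ⬝ᵥ (blockR bR (G X)).vec = _ ⬝ᵥ _
    rw [vec_blockR_lindblad bS bR hbar hH L hinv, dotProduct_mulVec, vecMul_vecMul,
      nonsing_inv_mul _ (isUnit_iff_ne_zero.2 hdet), vecMul_one]
    rfl
  have hmem : ∀ s, 0 ≤ s → evolution G s ρ ∈ densityOperators V := fun s hs =>
    evolution_mem_densityOperators hbar hH L hρ hs
  have hre : ∀ (φ : (V →L[ℂ] V) →L[ℂ] ℂ) (s : ℝ),
      HasDerivAt (fun s => (φ (evolution G s ρ)).re) (φ (G (evolution G s ρ))).re s := fun φ s =>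
    Complex.reCLM.hasFDerivAt.comp_hasDerivAt s (hasDerivAt_clm_evolution φ G ρ s)
  obtain ⟨C, hC⟩ := isCompact_densityOperators (V := V) |>.exists_bound_of_continuousOn
    (Complex.continuous_re.comp γ.continuous).continuousOn
  have hlim : Tendsto (fun s => (τ (evolution G s ρ)).re) atTop (𝓝 0) := by
    refine tendsto_zero_of_antitoneOn_of_bounded_primitive
      (g := fun s => (γ (evolution G s ρ)).re) (C := C) (fun s => ?_) ?_ (fun s hs => ?_)
      (fun s hs => hC _ (hmem s hs))
    · simpa only [hγ] using hre γ s
    · refine antitoneOn_of_deriv_nonpos (convex_Ici 0)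
        (fun s _ => (hre τ s).continuousAt.continuousWithinAt)
        (fun s _ => (hre τ s).differentiableAt.differentiableWithinAt) fun s hs => ?_
      rw [interior_Ici, Set.mem_Ioi] at hs
      rw [(hre τ s).deriv, hτ]
      exact re_trace_blockR_lindblad_nonpos bS bR hbar hH L hinv (hmem s hs.le).1
    · rw [hτ]
      exact (Complex.nonneg_iff.1 (posSemidef_blockR bR (hmem s hs).1).trace_nonneg).1
  refine isCompact_densityOperators.tendsto_zero_of_tendsto_zero
    (D := fun X => Metric.infEDist X (statesOn S)) Metric.continuous_infEDist (f := fun X => (τ X).re)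
    (Complex.continuous_re.comp τ.continuous) (fun X hX hle => ?_)
    ((eventually_ge_atTop 0).mono hmem) hlim
  refine Metric.infEDist_zero_of_mem (mem_statesOn_of_trace_blockR_eq_zero bR hX ?_)
  have h0 := Complex.nonneg_iff.1 (posSemidef_blockR bR hX.1).trace_nonneg
  rw [hτ] at hle
  exact Complex.ext (le_antisymm hle h0.1) h0.2.symm

end Main

end QDS

end

theorem mainTheorem1 {V : Type*} [NormedAddCommGroup V] [InnerProductSpace ℂ V]
    [CompleteSpace V] [FiniteDimensional ℂ V]
    (hbar : ℝ) (hbar_pos : 0 < hbar)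
    (H : V →L[ℂ] V) (hH : IsSelfAdjoint H) {p : ℕ} (L : Fin p → V →L[ℂ] V)
    (S : Submodule ℂ V) {m r : ℕ}
    (bS : OrthonormalBasis (Fin m) ℂ S) (bR : OrthonormalBasis (Fin r) ℂ Sᗮ)
    (hinv : QDS.IsInvariantSubspace (QDS.lindblad hbar H L) S) :
    (QDS.IsGAS (QDS.lindblad hbar H L) S ↔
      ¬ Module.End.HasEigenvalue
        (Matrix.toLin' (QDS.reducedGenerator hbar (QDS.blockR bR H)
          (fun k => QDS.blockR bR (L k)) (fun k => QDS.blockP bS bR (L k)))) 0) ∧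
    (∀ ρ ∈ QDS.densityOperators V, ∀ t : ℝ, 0 ≤ t →
      HasDerivAt
        (fun s : ℝ => (QDS.blockR bR (QDS.evolution (QDS.lindblad hbar H L) s ρ)).vec)
        (Matrix.mulVec
          (QDS.reducedGenerator hbar (QDS.blockR bR H)
            (fun k => QDS.blockR bR (L k)) (fun k => QDS.blockP bS bR (L k)))
          (QDS.blockR bR (QDS.evolution (QDS.lindblad hbar H L) t ρ)).vec) t) := by
  refine ⟨?_, fun ρ _ t _ => ?_⟩
  -- Entries 0 and 3 of the equivalence are the zero eigenvalue and the vanishing determinant.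
  · have hdet := ((Matrix.toLin' (QDS.reducedGenerator hbar (QDS.blockR bR H)
      (fun k => QDS.blockR bR (L k)) (fun k => QDS.blockP bS bR (L k)))).hasEigenvalue_zero_tfae).out
      0 3
    rw [hdet, LinearMap.det_toLin']
    exact ⟨fun h => QDS.det_reducedGenerator_ne_zero_of_isAttractive bS bR hbar hH L hinv h.2,
      fun h => ⟨hinv,
        QDS.isAttractive_of_det_reducedGenerator_ne_zero bS bR hbar hH L hinv h⟩⟩
  · rw [← QDS.vec_blockR_lindblad bS bR hbar hH L hinv]
    exact QDS.hasDerivAt_clm_evolution (QDS.vecBlockR bR) (QDS.lindblad hbar H L) ρ t
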